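/- All rings are commutative with $1$. A ring homomorphism $A\to B$ is \emph{localizing} if it identifies $B$ with a localization $M^{-1}A$ at a multiplicative subset $M\subseteq A$, and \emph{essentially of finite type} if $B$ is a localization of a finitely generated $A$-algebra. A morphism $f\colon X\to Y$ of noetherian schemes is \emph{essentially of finite type} (respectively \emph{localizing}) if every point of $Y$ has an affine open neighbourhood $V=\operatorname{Spec}A$ such that $f^{-1}(V)$ is covered by finitely many affine open subsets $U_i=\operatorname{Spec}B_i$ for which the induced ring homomorphisms $A\to B_i$ are essentially of finite type (respectively localizing). A \emph{localizing immersion} is a localizing morphism of noetherian schemes that is injective on underlying sets. \textbf{Theorem.} Let $f\colon X\to S$ be a separated morphism, essentially of finite type, of noetherian schemes. Then there exist a noetherian scheme $Y$ and morphisms $k\colon X\to Y$ and $p\colon Y\to S$ with $f=p\circ k$ such that $k$ is a localizing immersion and $p$ is separated and of finite type. -/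

import Mathlib

open CategoryTheory AlgebraicGeometry

universe u

namespace EssFactorization

/-- A ring homomorphism `φ : A →+* B` is *localizing* if it exhibits `B` as the localization
of `A` at some multiplicative subset. -/
def IsLocalizingHom {A B : Type u} [CommRing A] [CommRing B] (φ : A →+* B) : Prop :=
  ∃ M : Submonoid A, @IsLocalization A _ M B _ φ.toAlgebra

/-- For a property `P` of ring homomorphisms: every point `y : Y` has an affine open
neighbourhood `V` such that `f ⁻¹ V` is covered by finitely many affine opens `U i` of `X` for
which the ring homomorphisms `Γ(Y, V) → Γ(X, U i)` induced by `f` have property `P`. -/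
def HasFiniteAffineCovers
    (P : ∀ {A B : Type u} [CommRing A] [CommRing B], (A →+* B) → Prop)
    {X Y : Scheme.{u}} (f : X ⟶ Y) : Prop :=
  ∀ y : Y, ∃ V : Y.Opens, y ∈ V ∧ IsAffineOpen V ∧
    ∃ (n : ℕ) (U : Fin n → X.Opens) (hU : ∀ i, U i ≤ f ⁻¹ᵁ V),
      (⨆ i, U i) = f ⁻¹ᵁ V ∧ ∀ i, IsAffineOpen (U i) ∧ P (f.appLE V (U i) (hU i)).hom

/-- Essentially finite-type morphisms (used for noetherian schemes). -/
def IsEssFiniteType {X Y : Scheme.{u}} (f : X ⟶ Y) : Prop :=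
  HasFiniteAffineCovers (fun φ => φ.EssFiniteType) f

/-- Localizing morphisms (used for noetherian schemes). -/
def IsLocalizing {X Y : Scheme.{u}} (f : X ⟶ Y) : Prop :=
  HasFiniteAffineCovers (fun φ => IsLocalizingHom φ) f

/-- A localizing immersion is a localizing morphism that is injective on underlying sets
(used for noetherian schemes). -/
structure IsLocalizingImmersion {X Y : Scheme.{u}} (f : X ⟶ Y) : Prop where
  isLocalizing : IsLocalizing f
  injective : Function.Injective f

end EssFactorization

open Limits

namespace EssFactorization

/-! ### Localizing ring homomorphisms -/

section Rings

/-! For affine schemes, `B` is a localization of a finitely generated subalgebra `C`, and `Spec B →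
Spec C → Spec A` is the factorization. Since `C → B` is injective, `k` is schematically dominant, so
morphisms from `Y` to a separated scheme are determined on `X`. `IsInjLocalizing` carries this
injectivity through the proof.

In general, factorizations through `Y₁` and `Y₂` over two opens of `X` are glued. As `k` is a flat
preimmersion, it is an isomorphism on stalks. Finite type lets the comparison maps between the two
models of the overlap spread out to open neighbourhoods, and dominance makes them mutually inverse
(`exists_common_open`). Gluing along the common open gives `Y` of finite type over `S`, perhaps not
separated. The closure of its diagonal minus the diagonal is closed with finitely many generic
points. Each has a projection outside `k(X)`, and removing the closures of these projections leaves
a separated neighbourhood of `k(X)` (`exists_open_isSeparated`). Compactness of `X` reduces to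
finitely many gluings. -/

lemma isLocalizingHom_iff_isLocalization {A B : Type u} [CommRing A] [CommRing B] [Algebra A B] :
    IsLocalizingHom (algebraMap A B) ↔ ∃ M : Submonoid A, IsLocalization M B := by
  unfold IsLocalizingHom
  rw [toAlgebra_algebraMap]

lemma IsLocalizingHom.pushout_inr {A B C D : CommRingCat.{u}} {φ : A ⟶ B} {ψ : A ⟶ C}
    {inl : B ⟶ D} {inr : C ⟶ D} (h : IsPushout φ ψ inl inr) (hφ : IsLocalizingHom φ.hom) :
    IsLocalizingHom inr.hom := by
  obtain ⟨M, hM⟩ := hφ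
  algebraize [φ.hom, ψ.hom, inl.hom, inr.hom, inl.hom.comp φ.hom]
  have h1 : IsScalarTower A C D := .of_algebraMap_eq' (congrArg CommRingCat.Hom.hom h.w)
  have h2 : Algebra.IsPushout A B C D := CommRingCat.isPushout_iff_isPushout.mp h
  exact ⟨_, (Algebra.isLocalization_iff_isPushout M B).mpr h2.symm⟩

lemma IsLocalizingHom.isPreimmersion {A B : CommRingCat.{u}} {φ : A ⟶ B}
    (hφ : IsLocalizingHom φ.hom) : IsPreimmersion (Spec.map φ) := by
  obtain ⟨M, hM⟩ := hφ
  algebraize [φ.hom]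
  exact IsPreimmersion.of_isLocalization M

lemma IsLocalizingHom.flat {A B : CommRingCat.{u}} {φ : A ⟶ B}
    (hφ : IsLocalizingHom φ.hom) : Flat (Spec.map φ) := by
  obtain ⟨M, hM⟩ := hφ
  rw [Flat.SpecMap_iff]
  algebraize [φ.hom]
  exact IsLocalization.flat _ M

lemma IsLocalizingHom.of_arrowIso {A B A' B' : CommRingCat.{u}} {φ : A ⟶ B} {φ' : A' ⟶ B'}
    (e : Arrow.mk φ ≅ Arrow.mk φ') (hφ : IsLocalizingHom φ.hom) : IsLocalizingHom φ'.hom :=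
  hφ.pushout_inr (inl := e.hom.right) (ψ := e.hom.left) (IsPushout.of_vert_isIso ⟨e.hom.w.symm⟩)

end Rings

lemma _root_.AlgebraicGeometry.IsZariskiLocalAtTarget.of_forall_exists_isPullback
    {P : MorphismProperty Scheme.{u}} [IsZariskiLocalAtTarget P] {X Y : Scheme.{u}} (f : X ⟶ Y)
    (H : ∀ y : Y, ∃ (X' Y' : Scheme.{u}) (i : X' ⟶ X) (f' : X' ⟶ Y') (j : Y' ⟶ Y),
      IsOpenImmersion j ∧ y ∈ Set.range j ∧ IsPullback i f' f j ∧ P f') : P f := by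
  choose X' Y' i f' j hj hy hp hP using H
  refine IsZariskiLocalAtTarget.of_iSup_eq_top (fun y ↦ (j y).opensRange) ?_ fun y ↦ ?_
  · exact top_le_iff.mp fun y _ ↦ TopologicalSpace.Opens.mem_iSup.mpr ⟨y, hy y⟩
  · rw [P.arrow_mk_iso_iff (morphismRestrictOpensRange f (j y)),
      ← P.cancel_left_of_respectsIso (hp y).isoPullback.hom]
    simpa using hP y

/-- An isomorphism of morphisms of schemes induces one on global sections. -/
noncomputable def arrowIsoAppTop {X Y X' Y' : Scheme.{u}} {f : X ⟶ Y} {f' : X' ⟶ Y'}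
    (a : X ≅ X') (b : Y ≅ Y') (w : a.hom ≫ f' = f ≫ b.hom) :
    Arrow.mk f.appTop ≅ Arrow.mk f'.appTop :=
  Arrow.isoMk' _ _ (Scheme.Γ.mapIso b.symm.op) (Scheme.Γ.mapIso a.symm.op) (by
    change b.inv.appTop ≫ f'.appTop = f.appTop ≫ a.inv.appTop
    rw [← Scheme.Hom.comp_appTop, ← Scheme.Hom.comp_appTop]
    congr 1
    rw [Iso.comp_inv_eq, Category.assoc, ← w, Iso.inv_hom_id_assoc])

/-- A morphism is *an injective localization on an affine cover* if its target is covered by affine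
opens over each of which it is the spectrum of an injective localizing ring homomorphism. -/
def IsInjLocalizing {X Y : Scheme.{u}} (k : X ⟶ Y) : Prop :=
  ∀ y : Y, ∃ (A B : CommRingCat.{u}) (φ : A ⟶ B) (i : Spec B ⟶ X) (j : Spec A ⟶ Y),
    IsOpenImmersion j ∧ y ∈ Set.range j ∧ IsPullback i (Spec.map φ) k j ∧
      IsLocalizingHom φ.hom ∧ Function.Injective φ

/-! ### Morphisms that are injective localizations on affine charts -/

namespace IsInjLocalizing

variable {X Y : Scheme.{u}} {k : X ⟶ Y}

/-- A chart of `k` is shrunk to an affine open contained in `Y'`. On rings this is a flat base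
change, which preserves both localization and injectivity. -/
lemma of_isPullback (hk : IsInjLocalizing k) {X' Y' : Scheme.{u}} {i : X' ⟶ X} {k' : X' ⟶ Y'}
    {j : Y' ⟶ Y} [IsOpenImmersion j] (h : IsPullback i k' k j) : IsInjLocalizing k' := by
  intro y'
  obtain ⟨A, B, φ, i₁, j₁, hj₁, ⟨a, ha⟩, h₁, hφ, hinj⟩ := hk (j y')
  obtain ⟨A', ψ', hψ', ⟨a', rfl⟩, hsub⟩ :=
    Scheme.exists_affine_mem_range_and_range_subset (U := j₁ ⁻¹ᵁ j.opensRange) (x := a)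
      (by simp [ha])
  obtain ⟨ψ, rfl⟩ := Spec.map_surjective ψ'
  have hr : Set.range (Spec.map ψ ≫ j₁) ⊆ Set.range j := by
    rintro _ ⟨z, rfl⟩
    exact hsub ⟨z, rfl⟩
  have hflat : ψ.hom.Flat := Flat.SpecMap_iff.mp inferInstance
  let j₂ := IsOpenImmersion.lift j (Spec.map ψ ≫ j₁) hr
  have hj₂ : j₂ ≫ j = Spec.map ψ ≫ j₁ := IsOpenImmersion.lift_fac _ _ _
  have : IsOpenImmersion j₂ :=
    have : IsOpenImmersion (j₂ ≫ j) := by rw [hj₂]; infer_instance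
    .of_comp _ j
  have hbig : IsPullback (Spec.map (pushout.inl φ ψ) ≫ i₁) (Spec.map (pushout.inr φ ψ)) k
      (Spec.map ψ ≫ j₁) := (isPullback_SpecMap_pushout φ ψ).flip.paste_vert h₁.flip |>.flip
  rw [← hj₂] at hbig
  refine ⟨A', pushout φ ψ, pushout.inr φ ψ, h.lift (Spec.map (pushout.inl φ ψ) ≫ i₁)
    (Spec.map (pushout.inr φ ψ) ≫ j₂) (by simpa using hbig.w), j₂, this, ⟨a', ?_⟩, ?_,
    hφ.pushout_inr (.of_hasPushout φ ψ), CommRingCat.inr_injective_of_flat φ ψ hinj hflat⟩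
  · apply j.isOpenEmbedding.injective
    rw [← Scheme.Hom.comp_apply, hj₂, Scheme.Hom.comp_apply, ha]
  · exact (IsPullback.of_bot (by simpa using hbig.flip) (by simp) h.flip).flip

lemma of_forall_exists (H : ∀ y : Y, ∃ (X' Y' : Scheme.{u}) (i : X' ⟶ X) (k' : X' ⟶ Y')
    (j : Y' ⟶ Y), IsOpenImmersion j ∧ y ∈ Set.range j ∧ IsPullback i k' k j ∧
      IsInjLocalizing k') : IsInjLocalizing k := by
  intro y
  obtain ⟨X', Y', i, k', j, hj, ⟨y', rfl⟩, h, hk'⟩ := H y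
  obtain ⟨A, B, φ, i₁, j₁, hj₁, ⟨a, rfl⟩, h₁, hφ, hinj⟩ := hk' y'
  exact ⟨A, B, φ, i₁ ≫ i, j₁ ≫ j, inferInstance, ⟨a, by simp⟩,
    (h₁.flip.paste_vert h.flip).flip, hφ, hinj⟩

lemma of_isIso [IsIso k] : IsInjLocalizing k := by
  intro y
  obtain ⟨A, j, hj, hy, -⟩ :=
    Scheme.exists_affine_mem_range_and_range_subset (U := ⊤) (x := y) trivial
  refine ⟨A, A, 𝟙 A, j ≫ inv k, j, hj, hy, ?_, ?_, fun _ _ h ↦ h⟩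
  · rw [Spec.map_id]
    exact IsPullback.of_vert_isIso ⟨by simp⟩
  · exact isLocalizingHom_iff_isLocalization (A := A) (B := A).mpr ⟨IsUnit.submonoid A, inferInstance⟩

lemma of_specMap {A B : CommRingCat.{u}} {φ : A ⟶ B} (hφ : IsLocalizingHom φ.hom)
    (hinj : Function.Injective φ) : IsInjLocalizing (Spec.map φ) := fun y ↦
  ⟨A, B, φ, 𝟙 _, 𝟙 _, inferInstance, ⟨y, by simp⟩, .of_id_fst, hφ, hinj⟩

lemma isPreimmersion (hk : IsInjLocalizing k) : IsPreimmersion k := by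
  refine IsZariskiLocalAtTarget.of_forall_exists_isPullback (P := @IsPreimmersion) k fun y ↦ ?_
  obtain ⟨A, B, φ, i, j, hj, hy, h, hφ, -⟩ := hk y
  exact ⟨_, _, i, Spec.map φ, j, hj, hy, h, hφ.isPreimmersion⟩

lemma flat (hk : IsInjLocalizing k) : Flat k := by
  have : IsZariskiLocalAtTarget @Flat := HasRingHomProperty.instIsZariskiLocalAtTarget _
  refine IsZariskiLocalAtTarget.of_forall_exists_isPullback (P := @Flat) k fun y ↦ ?_
  obtain ⟨A, B, φ, i, j, hj, hy, h, hφ, -⟩ := hk y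
  exact ⟨_, _, i, Spec.map φ, j, hj, hy, h, hφ.flat⟩

/-- A chart of an injective localizing morphism, in terms of affine opens. -/
lemma exists_isAffineOpen (hk : IsInjLocalizing k) (y : Y) : ∃ V : Y.Opens, y ∈ V ∧
    IsAffineOpen V ∧ IsAffineOpen (k ⁻¹ᵁ V) ∧ IsLocalizingHom (k.app V).hom ∧
      Function.Injective (k.app V) := by
  obtain ⟨A, B, φ, i, j, hj, hy, h, hφ, hinj⟩ := hk y
  have hi : IsOpenImmersion i := MorphismProperty.of_isPullback (P := @IsOpenImmersion) h.flip hj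
  have hr : k ⁻¹ᵁ j.opensRange = i.opensRange := by
    have := IsOpenImmersion.image_preimage_eq_preimage_image_of_isPullback h.flip ⊤
    simpa using this.symm
  have e₁ : Arrow.mk (Spec.map φ) ≅ Arrow.mk (k ∣_ j.opensRange) :=
    (Arrow.isoMk' _ _ h.isoPullback (Iso.refl _) (by simp)) ≪≫ (morphismRestrictOpensRange k j).symm
  have e₂ : Arrow.mk (Spec.map φ).appTop ≅ Arrow.mk (k ∣_ j.opensRange).appTop :=
    arrowIsoAppTop (Arrow.leftFunc.mapIso e₁) (Arrow.rightFunc.mapIso e₁) e₁.hom.w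
  have e₃ : Arrow.mk (k ∣_ j.opensRange).appTop ≅ Arrow.mk (k.app j.opensRange) := by
    rw [← Scheme.Hom.resLE_eq_morphismRestrict, Scheme.Hom.app_eq_appLE]
    exact arrowResLEAppIso _ _ _ _
  have e : Arrow.mk φ ≅ Arrow.mk (k.app j.opensRange) := arrowIsoΓSpecOfIsAffine φ ≪≫ e₂ ≪≫ e₃
  refine ⟨j.opensRange, hy, isAffineOpen_opensRange j, hr ▸ isAffineOpen_opensRange i,
    hφ.of_arrowIso e, ?_⟩
  have : k.app j.opensRange = e.inv.left ≫ φ ≫ e.hom.right := by simp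
  rw [this]
  exact ((ConcreteCategory.bijective_of_isIso e.hom.right).injective.comp hinj).comp
    (ConcreteCategory.bijective_of_isIso e.inv.left).injective

lemma isAffineHom (hk : IsInjLocalizing k) : IsAffineHom k :=
  isAffineHom_of_forall_exists_isAffineOpen k fun y ↦
    let ⟨V, hy, hV, hU, _⟩ := hk.exists_isAffineOpen y
    ⟨V, hy, hV, hU⟩

/-- The kernel ideal sheaf can be computed on the affine charts, where injectivity makes it zero. -/
lemma isSchemeTheoreticallyDominant (hk : IsInjLocalizing k) :
    IsSchemeTheoreticallyDominant k := by
  have := hk.isAffineHom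
  choose V hy hV _ _ hinj using hk.exists_isAffineOpen
  refine ⟨Scheme.IdealSheafData.ext_of_iSup_eq_top (fun y ↦ ⟨V y, hV y⟩)
    (top_le_iff.mp fun y _ ↦ TopologicalSpace.Opens.mem_iSup.mpr ⟨y, hy y⟩) fun y ↦ ?_⟩
  rw [k.ker_apply, (RingHom.injective_iff_ker_eq_bot _).mp (hinj y)]
  simp

lemma isLocalizing (hk : IsInjLocalizing k) : IsLocalizing k := fun y ↦ by
  obtain ⟨V, hy, hV, hU, hl, -⟩ := hk.exists_isAffineOpen y
  refine ⟨V, hy, hV, 1, fun _ ↦ k ⁻¹ᵁ V, fun _ ↦ le_rfl, by simp, fun _ ↦ ⟨hU, ?_⟩⟩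
  rwa [← Scheme.Hom.app_eq_appLE]

lemma isLocalizingImmersion (hk : IsInjLocalizing k) : IsLocalizingImmersion k :=
  have := hk.isPreimmersion
  ⟨hk.isLocalizing, k.isEmbedding.injective⟩

/-- Affine morphisms that are essentially of finite type factor as required. -/
lemma exists_factorization_of_isAffine {X S : Scheme.{u}} [IsAffine X] [IsAffine S] (f : X ⟶ S)
    (hf : f.appTop.hom.EssFiniteType) : ∃ (Y : Scheme.{u}) (k : X ⟶ Y) (p : Y ⟶ S), k ≫ p = f ∧
      IsInjLocalizing k ∧ IsSeparated p ∧ LocallyOfFiniteType p ∧ QuasiCompact p := by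
  algebraize [f.appTop.hom]
  -- A finitely generated subalgebra that localizes to `Γ(X, ⊤)`; as a subalgebra it has an
  -- injective inclusion.
  let C := Algebra.EssFiniteType.subalgebra Γ(S, ⊤) Γ(X, ⊤)
  let φ : CommRingCat.of C ⟶ Γ(X, ⊤) := CommRingCat.ofHom C.val.toRingHom
  let ψ : Γ(S, ⊤) ⟶ CommRingCat.of C := CommRingCat.ofHom (algebraMap _ C)
  have hψφ : ψ ≫ φ = f.appTop := by
    ext x
    rfl
  have hφ : IsLocalizingHom φ.hom := isLocalizingHom_iff_isLocalization.mpr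
    ⟨Algebra.EssFiniteType.submonoid Γ(S, ⊤) Γ(X, ⊤), inferInstance⟩
  have hψ : LocallyOfFiniteType (Spec.map ψ) := by
    rw [HasRingHomProperty.Spec_iff (P := @LocallyOfFiniteType)]
    exact RingHom.finiteType_algebraMap.mpr inferInstance
  refine ⟨Spec (.of C), X.isoSpec.hom ≫ Spec.map φ, Spec.map ψ ≫ S.isoSpec.inv, ?_, ?_,
    inferInstance, inferInstance, inferInstance⟩
  · rw [Category.assoc, ← Spec.map_comp_assoc, hψφ, Scheme.isoSpec_inv_naturality,
      Iso.hom_inv_id_assoc]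
  · exact (of_specMap hφ Subtype.val_injective).of_isPullback (i := X.isoSpec.hom) (j := 𝟙 _)
      (IsPullback.of_horiz_isIso ⟨by simp⟩)

end IsInjLocalizing

/-- Morphisms to a separated scheme that agree after precomposition with a scheme-theoretically
dominant morphism are equal. -/
lemma ext_of_isSchemeTheoreticallyDominant {W X Y Z : Scheme.{u}} {f g : X ⟶ Y} (s : Y ⟶ Z)
    [IsSeparated s] (h : f ≫ s = g ≫ s) (j : W ⟶ X) [IsSchemeTheoreticallyDominant j]
    (hU : j ≫ f = j ≫ g) : f = g := by
  let X' : Over Z := Over.mk (f ≫ s)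
  let Y' : Over Z := Over.mk s
  let U' : Over Z := Over.mk (j ≫ f ≫ s)
  let f' : X' ⟶ Y' := Over.homMk f
  let g' : X' ⟶ Y' := Over.homMk g
  let j' : U' ⟶ X' := Over.homMk j
  have : IsSeparated Y'.hom := ‹_›
  have hj : (equalizer.lift j' (by ext1; exact hU)).left ≫ (equalizer.ι f' g').left = j := by
    rw [← Over.comp_left, equalizer.lift_ι]
    rfl
  -- The equalizer is a closed subscheme because `s` is separated, and `j` factors through it, so
  -- its ideal lies in `ker j = 0`.
  have : IsIso (equalizer.ι f' g').left := by
    rw [IsClosedImmersion.isIso_iff_ker_eq_bot, ← le_bot_iff]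
    refine (Scheme.Hom.le_ker_comp (equalizer.lift j' (by ext1; exact hU)).left _).trans ?_
    rw [hj, j.ker_eq_bot]
  rw [← cancel_epi (equalizer.ι f' g').left]
  exact congr($(equalizer.condition f' g').left)

/-- A flat local homomorphism is faithfully flat, hence injective. -/
lemma isIso_stalkMap_of_flat {X Y : Scheme.{u}} (k : X ⟶ Y) [Flat k] [SurjectiveOnStalks k]
    (x : X) : IsIso (k.stalkMap x) := by
  refine (ConcreteCategory.isIso_iff_bijective _).mpr ⟨?_, k.stalkMap_surjective x⟩
  have h := Flat.stalkMap k x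
  have hl := k.toLRSHom.prop x
  algebraize [(k.stalkMap x).hom]
  have : Module.FaithfullyFlat (Y.presheaf.stalk (k x)) (X.presheaf.stalk x) :=
    @Module.FaithfullyFlat.of_flat_of_isLocalHom _ _ _ _ _ _ _ h hl
  exact FaithfulSMul.algebraMap_injective (Y.presheaf.stalk (k x)) (X.presheaf.stalk x)

/-! ### Extending morphisms from `X` to a neighbourhood in `Y` -/

section Extension

variable {X Y T S : Scheme.{u}} (k : X ⟶ Y) (p : Y ⟶ S) (t : T ⟶ S) (g : X ⟶ T)

/-- Through the stalk isomorphism, `g` defines a morphism on the local scheme of `Y` at `k x`, which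
spreads out because `t` is locally of finite type. -/
lemma exists_extension_stalk [IsLocallyNoetherian Y] (x : X) [IsIso (k.stalkMap x)]
    [LocallyOfFiniteType t] (h : g ≫ t = k ≫ p) :
    ∃ (U : Y.Opens) (hU : k x ∈ U) (f : U.toScheme ⟶ T), f ≫ t = U.ι ≫ p ∧
      U.fromSpecStalkOfMem (k x) hU ≫ f =
        inv (Spec.map (k.stalkMap x)) ≫ X.fromSpecStalk x ≫ g := by
  obtain ⟨U, hU, f, hf, hft⟩ := spread_out_of_isGermInjective' p t (x := k x)
    (inv (Spec.map (k.stalkMap x)) ≫ X.fromSpecStalk x ≫ g) (by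
      rw [Category.assoc, Category.assoc, h, IsIso.inv_comp_eq,
        Scheme.SpecMap_stalkMap_fromSpecStalk_assoc])
  exact ⟨U, hU, f, hft, hf.symm⟩

lemma fromSpecStalk_opens (U : Y.Opens) (y : Y) (hy : y ∈ U) :
    ∃ a, U.toScheme.fromSpecStalk ⟨y, hy⟩ = a ≫ U.fromSpecStalkOfMem y hy := by
  refine ⟨Spec.map (U.ι.stalkMap ⟨y, hy⟩), (cancel_mono U.ι).mp ?_⟩
  rw [Category.assoc, Scheme.Opens.fromSpecStalkOfMem_ι]
  exact (Scheme.SpecMap_stalkMap_fromSpecStalk U.ι (x := ⟨y, hy⟩)).symm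

lemma exists_restrict_eq_of_fromSpecStalk [IsLocallyNoetherian X] (x : X) (U : Y.Opens)
    (hU : k x ∈ U) (f : U.toScheme ⟶ T)
    (hf : Spec.map (k.stalkMap x) ≫ U.fromSpecStalkOfMem (k x) hU ≫ f =
      X.fromSpecStalk x ≫ g) :
    ∃ W : (k ⁻¹ᵁ U).toScheme.Opens, (⟨x, hU⟩ : k ⁻¹ᵁ U) ∈ W ∧
      W.ι ≫ (k ∣_ U) ≫ f = W.ι ≫ (k ⁻¹ᵁ U).ι ≫ g := by
  have hx : x ∈ k ⁻¹ᵁ U := hU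
  have key : (k ⁻¹ᵁ U).fromSpecStalkOfMem x hx ≫ (k ∣_ U) =
      Spec.map (k.stalkMap x) ≫ U.fromSpecStalkOfMem (k x) hU := by
    rw [← cancel_mono U.ι, Category.assoc, Category.assoc, morphismRestrict_ι,
      Scheme.Opens.fromSpecStalkOfMem_ι_assoc, Scheme.Opens.fromSpecStalkOfMem_ι,
      Scheme.SpecMap_stalkMap_fromSpecStalk]
  have key' : (k ⁻¹ᵁ U).fromSpecStalkOfMem x hx ≫ (k ∣_ U) ≫ f =
      (k ⁻¹ᵁ U).fromSpecStalkOfMem x hx ≫ (k ⁻¹ᵁ U).ι ≫ g := by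
    rw [reassoc_of% key, hf, Scheme.Opens.fromSpecStalkOfMem_ι_assoc]
  have hg : (k ⁻¹ᵁ U).toScheme.IsGermInjective := inferInstance
  have := hg ⟨x, hx⟩
  refine spread_out_unique_of_isGermInjective' (X := (k ⁻¹ᵁ U).toScheme) (x := ⟨x, hx⟩) _ _ ?_
  obtain ⟨a, ha⟩ := fromSpecStalk_opens (k ⁻¹ᵁ U) x hx
  rw [ha, Category.assoc, Category.assoc, key']

/-- The spread-out morphism agrees with `g` only on some neighbourhood of `x` in `X`. As `X` has the
subspace topology, this is the trace of an open of `Y`, and shrinking `U` to it gives agreement on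
all of `k ⁻¹ᵁ U`. -/
lemma exists_extension_at [IsLocallyNoetherian X] [IsLocallyNoetherian Y] [IsPreimmersion k]
    [Flat k] [LocallyOfFiniteType t] (h : g ≫ t = k ≫ p) (x : X) :
    ∃ (U : Y.Opens) (f : U.toScheme ⟶ T), k x ∈ U ∧ f ≫ t = U.ι ≫ p ∧
      ∀ {P : Scheme.{u}} (a : P ⟶ X) (b : P ⟶ U.toScheme), a ≫ k = b ≫ U.ι → b ≫ f = a ≫ g := by
  have := isIso_stalkMap_of_flat k x
  obtain ⟨U, hU, f, hft, hf⟩ := exists_extension_stalk k p t g x h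
  obtain ⟨W, hxW, hW⟩ := exists_restrict_eq_of_fromSpecStalk k g x U hU f
    (by rw [hf, IsIso.hom_inv_id_assoc])
  obtain ⟨O, hO, hOW⟩ := k.isEmbedding.isOpen_iff.mp ((k ⁻¹ᵁ U).ι ''ᵁ W).isOpen
  let O' : Y.Opens := ⟨O, hO⟩
  have hOW' : k ⁻¹ᵁ O' = (k ⁻¹ᵁ U).ι ''ᵁ W := TopologicalSpace.Opens.ext hOW
  have hxO : x ∈ k ⁻¹ᵁ O' := by
    rw [hOW']
    exact ⟨_, hxW, rfl⟩
  refine ⟨U ⊓ O', Y.homOfLE inf_le_left ≫ f, ⟨hU, hxO⟩, by simp [hft], fun {P} a b hab ↦ ?_⟩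
  have hr : Set.range a ⊆ Set.range (W.ι ≫ (k ⁻¹ᵁ U).ι) := by
    rintro _ ⟨z, rfl⟩
    have hz : a z ∈ k ⁻¹ᵁ O' := by
      change k (a z) ∈ O'
      rw [← Scheme.Hom.comp_apply, hab, Scheme.Hom.comp_apply]
      exact (b z).2.2
    rw [hOW'] at hz
    obtain ⟨w, hw, hwz⟩ := hz
    exact ⟨⟨w, hw⟩, hwz⟩
  obtain ⟨l, hl⟩ : ∃ l, l ≫ W.ι ≫ (k ⁻¹ᵁ U).ι = a := ⟨_, IsOpenImmersion.lift_fac _ a hr⟩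
  have hb : l ≫ W.ι ≫ (k ∣_ U) =
      b ≫ Y.homOfLE inf_le_left := by
    rw [← cancel_mono U.ι]
    simp only [Category.assoc, morphismRestrict_ι, Scheme.homOfLE_ι, ← hab]
    rw [← hl]
    simp only [Category.assoc]
  rw [← reassoc_of% hb, hW, ← reassoc_of% hl]

lemma exists_glue_opens {ι : Type u} (U : ι → Y.Opens) (f : ∀ i, (U i).toScheme ⟶ T)
    (h : ∀ i j {P : Scheme.{u}} (a : P ⟶ U i) (b : P ⟶ U j) [IsOpenImmersion a],
      a ≫ (U i).ι = b ≫ (U j).ι → a ≫ f i = b ≫ f j) :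
    ∃ φ : (⨆ i, U i).toScheme ⟶ T, ∀ i, Y.homOfLE (le_iSup U i) ≫ φ = f i := by
  have hc (i j) : pullback.fst (Y.homOfLE (le_iSup U i)) (Y.homOfLE (le_iSup U j)) ≫ (U i).ι =
      pullback.snd (Y.homOfLE (le_iSup U i)) (Y.homOfLE (le_iSup U j)) ≫ (U j).ι := by
    have := (pullback.condition (f := Y.homOfLE (le_iSup U i)) (g := Y.homOfLE (le_iSup U j))) =≫
      (⨆ i, U i).ι
    simpa using this
  exact ⟨(Scheme.Opens.iSupOpenCover U).glueMorphisms f fun i j ↦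
    h i j (pullback.fst (Y.homOfLE (le_iSup U i)) (Y.homOfLE (le_iSup U j))) _ (hc i j),
    fun i ↦ (Scheme.Opens.iSupOpenCover U).ι_glueMorphisms _ _ i⟩

lemma exists_extension [IsLocallyNoetherian X] [IsLocallyNoetherian Y] [IsPreimmersion k]
    [Flat k] [QuasiCompact k] [IsSchemeTheoreticallyDominant k] [LocallyOfFiniteType t]
    [IsSeparated t] (h : g ≫ t = k ≫ p) :
    ∃ (N : Y.Opens) (κ : X ⟶ N.toScheme) (f : N.toScheme ⟶ T), κ ≫ N.ι = k ∧ κ ≫ f = g ∧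
      f ≫ t = N.ι ≫ p := by
  choose U f hU hft hf using exists_extension_at k p t g h
  obtain ⟨φ, hφ⟩ := exists_glue_opens U f fun x y P a b _ hab ↦ by
    -- Dominance of `k` persists under base change to the open `P`, and over `X` both extensions
    -- restrict to `g`.
    refine ext_of_isSchemeTheoreticallyDominant t ?_ (pullback.snd k (a ≫ (U x).ι)) ?_
    · rw [Category.assoc, Category.assoc, hft, hft, reassoc_of% hab]
    · have h1 := hf x (pullback.fst k (a ≫ (U x).ι)) (pullback.snd k (a ≫ (U x).ι) ≫ a)
        (by rw [pullback.condition, Category.assoc])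
      have h2 := hf y (pullback.fst k (a ≫ (U x).ι)) (pullback.snd k (a ≫ (U x).ι) ≫ b)
        (by rw [pullback.condition, Category.assoc, hab])
      rw [← Category.assoc, h1, ← Category.assoc, h2]
  have hr : Set.range k ⊆ Set.range (⨆ i, U i).ι := by
    rintro _ ⟨x, rfl⟩
    simpa using ⟨x, hU x⟩
  refine ⟨⨆ i, U i, IsOpenImmersion.lift _ k hr, φ, IsOpenImmersion.lift_fac _ _ _, ?_, ?_⟩
  · refine Scheme.hom_ext_of_forall _ _ fun x ↦ ⟨k ⁻¹ᵁ U x, hU x, ?_⟩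
    rw [← hf x (k ⁻¹ᵁ U x).ι (k ∣_ U x) (by simp), ← hφ, ← Category.assoc, ← Category.assoc]
    congr 1
    rw [← cancel_mono (⨆ i, U i).ι]
    simp
  · have (x : X) : Y.homOfLE (le_iSup U x) ≫ φ ≫ t =
        Y.homOfLE (le_iSup U x) ≫ (⨆ i, U i).ι ≫ p := by
      rw [reassoc_of% hφ, hft, Scheme.homOfLE_ι_assoc]
    exact (Scheme.Opens.iSupOpenCover U).hom_ext _ _ this

end Extension

/-! ### Common open neighbourhoods and gluing along them -/

lemma isSchemeTheoreticallyDominant_of_comp {X N Y : Scheme.{u}} (κ : X ⟶ N) (j : N ⟶ Y)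
    [IsOpenImmersion j] [QuasiCompact (κ ≫ j)] [IsSchemeTheoreticallyDominant (κ ≫ j)] :
    IsSchemeTheoreticallyDominant κ := by
  have hr : Set.range (κ ≫ j) ⊆ Set.range j := by
    rintro _ ⟨x, rfl⟩
    exact ⟨κ x, rfl⟩
  have h := IsOpenImmersion.isPullback_lift_id (κ ≫ j) j hr
  rw [← IsOpenImmersion.lift_uniq j (κ ≫ j) hr κ rfl] at h
  exact .of_isPullback h.flip

/-- This is `ψ ∘ φ = id` on `φ⁻¹(N₂)`: it holds on `X`, which is schematically dense there, and `Y₁`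
is separated over `S`. -/
lemma fst_comp_ι_eq_snd_comp {X Y₁ Y₂ S : Scheme.{u}} (k₁ : X ⟶ Y₁) {k₂ : X ⟶ Y₂} (p₁ : Y₁ ⟶ S)
    (p₂ : Y₂ ⟶ S) [QuasiCompact k₁] [IsSchemeTheoreticallyDominant k₁] [IsSeparated p₁]
    {N₁ : Y₁.Opens} {N₂ : Y₂.Opens} {κ₁ : X ⟶ N₁.toScheme} {κ₂ : X ⟶ N₂.toScheme}
    {φ : N₁.toScheme ⟶ Y₂} {ψ : N₂.toScheme ⟶ Y₁} (h₁ : κ₁ ≫ N₁.ι = k₁) (hφ : κ₁ ≫ φ = k₂)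
    (h₂ : κ₂ ≫ N₂.ι = k₂) (hψ : κ₂ ≫ ψ = k₁) (hφp : φ ≫ p₂ = N₁.ι ≫ p₁)
    (hψp : ψ ≫ p₁ = N₂.ι ≫ p₂) :
    pullback.fst φ N₂.ι ≫ N₁.ι = pullback.snd φ N₂.ι ≫ ψ := by
  obtain ⟨κ, hκ₁, hκ₂⟩ : ∃ κ : X ⟶ pullback φ N₂.ι, κ ≫ pullback.fst _ _ = κ₁ ∧
      κ ≫ pullback.snd _ _ = κ₂ :=
    ⟨pullback.lift κ₁ κ₂ (by rw [hφ, h₂]), pullback.lift_fst _ _ _, pullback.lift_snd _ _ _⟩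
  have hκ : κ ≫ pullback.fst φ N₂.ι ≫ N₁.ι = k₁ := by rw [reassoc_of% hκ₁, h₁]
  have : QuasiCompact (κ ≫ pullback.fst φ N₂.ι ≫ N₁.ι) := by rwa [hκ]
  have : IsSchemeTheoreticallyDominant (κ ≫ pullback.fst φ N₂.ι ≫ N₁.ι) := by rwa [hκ]
  have := isSchemeTheoreticallyDominant_of_comp κ (pullback.fst φ N₂.ι ≫ N₁.ι)
  refine ext_of_isSchemeTheoreticallyDominant p₁ ?_ κ ?_
  · rw [Category.assoc, Category.assoc, hψp, ← hφp, pullback.condition_assoc]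
  · rw [hκ, reassoc_of% hκ₂, hψ]

/-- If `X` embeds as a dense pro-open subscheme in two separated `S`-schemes of finite type, then
these share an open neighbourhood of `X`. -/
lemma exists_common_open {X Y₁ Y₂ S : Scheme.{u}} (k₁ : X ⟶ Y₁) (k₂ : X ⟶ Y₂) (p₁ : Y₁ ⟶ S)
    (p₂ : Y₂ ⟶ S) [IsLocallyNoetherian X] [IsLocallyNoetherian Y₁] [IsLocallyNoetherian Y₂]
    [IsPreimmersion k₁] [Flat k₁] [QuasiCompact k₁] [IsSchemeTheoreticallyDominant k₁]
    [IsPreimmersion k₂] [Flat k₂] [QuasiCompact k₂] [IsSchemeTheoreticallyDominant k₂]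
    [LocallyOfFiniteType p₁] [IsSeparated p₁] [LocallyOfFiniteType p₂] [IsSeparated p₂]
    (h : k₁ ≫ p₁ = k₂ ≫ p₂) :
    ∃ (N : Scheme.{u}) (κ : X ⟶ N) (j₁ : N ⟶ Y₁) (j₂ : N ⟶ Y₂), IsOpenImmersion j₁ ∧
      IsOpenImmersion j₂ ∧ κ ≫ j₁ = k₁ ∧ κ ≫ j₂ = k₂ ∧ j₁ ≫ p₁ = j₂ ≫ p₂ := by
  obtain ⟨N₁, κ₁, φ, h₁, hφ, hφp⟩ := exists_extension k₁ p₁ p₂ k₂ h.symm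
  obtain ⟨N₂, κ₂, ψ, h₂, hψ, hψp⟩ := exists_extension k₂ p₂ p₁ k₁ h
  obtain ⟨κ, hκ₁, hκ₂⟩ : ∃ κ : X ⟶ pullback φ N₂.ι, κ ≫ pullback.fst _ _ = κ₁ ∧
      κ ≫ pullback.snd _ _ = κ₂ :=
    ⟨pullback.lift κ₁ κ₂ (by rw [hφ, h₂]), pullback.lift_fst _ _ _, pullback.lift_snd _ _ _⟩
  have e₁ := fst_comp_ι_eq_snd_comp k₁ p₁ p₂ h₁ hφ h₂ hψ hφp hψp
  have e₂ := fst_comp_ι_eq_snd_comp k₂ p₂ p₁ h₂ hψ h₁ hφ hψp hφp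
  -- The swap identifies `φ⁻¹(N₂)` with `ψ⁻¹(N₁)`, so the common open is open in `Y₂` as well as in
  -- `Y₁`.
  let σ : pullback φ N₂.ι ⟶ pullback ψ N₁.ι := pullback.lift (pullback.snd _ _) (pullback.fst _ _)
    e₁.symm
  let τ : pullback ψ N₁.ι ⟶ pullback φ N₂.ι := pullback.lift (pullback.snd _ _) (pullback.fst _ _)
    e₂.symm
  have : IsIso σ := ⟨τ,
    pullback.hom_ext (by rw [Category.assoc, pullback.lift_fst, pullback.lift_snd, Category.id_comp])
      (by rw [Category.assoc, pullback.lift_snd, pullback.lift_fst, Category.id_comp]),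
    pullback.hom_ext (by rw [Category.assoc, pullback.lift_fst, pullback.lift_snd, Category.id_comp])
      (by rw [Category.assoc, pullback.lift_snd, pullback.lift_fst, Category.id_comp])⟩
  have hσ : σ ≫ pullback.fst ψ N₁.ι ≫ N₂.ι = pullback.snd φ N₂.ι ≫ N₂.ι :=
    pullback.lift_fst_assoc _ _ _ _
  refine ⟨pullback φ N₂.ι, κ, pullback.fst _ _ ≫ N₁.ι,
    pullback.snd _ _ ≫ N₂.ι, inferInstance, ?_, by rw [reassoc_of% hκ₁, h₁],
    by rw [reassoc_of% hκ₂, h₂], ?_⟩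
  · rw [← hσ]
    infer_instance
  · rw [Category.assoc, Category.assoc, ← hφp, pullback.condition_assoc]

/-- Two schemes can be glued along an open subscheme. -/
lemma exists_glue {N Y₁ Y₂ : Scheme.{u}} (j₁ : N ⟶ Y₁) (j₂ : N ⟶ Y₂) [IsOpenImmersion j₁]
    [IsOpenImmersion j₂] :
    ∃ (Y : Scheme.{u}) (i₁ : Y₁ ⟶ Y) (i₂ : Y₂ ⟶ Y), IsOpenImmersion i₁ ∧ IsOpenImmersion i₂ ∧
      IsPushout j₁ j₂ i₁ i₂ ∧ (∀ y, y ∈ Set.range i₁ ∨ y ∈ Set.range i₂) ∧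
      ∀ y₁ y₂, i₁ y₁ = i₂ y₂ → ∃ n, j₁ n = y₁ ∧ j₂ n = y₂ := by
  have (i j) (f : i ⟶ j) : IsOpenImmersion ((span j₁ j₂).map f) := by
    rcases f with (_ | (_ | _))
    · exact inferInstanceAs (IsOpenImmersion (𝟙 _))
    · exact ‹IsOpenImmersion j₁›
    · exact ‹IsOpenImmersion j₂›
  refine ⟨pushout j₁ j₂, pushout.inl j₁ j₂, pushout.inr j₁ j₂,
    inferInstanceAs (IsOpenImmersion (colimit.ι (span j₁ j₂) WalkingSpan.left)),
    inferInstanceAs (IsOpenImmersion (colimit.ι (span j₁ j₂) WalkingSpan.right)),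
    .of_hasPushout _ _, fun y ↦ ?_, fun y₁ y₂ h ↦ ?_⟩
  · obtain ⟨i, y, rfl⟩ := Scheme.IsLocallyDirected.ι_jointly_surjective (span j₁ j₂) y
    rcases i with (_ | (_ | _))
    · refine Or.inl ⟨j₁ y, ?_⟩
      rw [← colimit.w (span j₁ j₂) WalkingSpan.Hom.fst]
      rfl
    · exact Or.inl ⟨y, rfl⟩
    · exact Or.inr ⟨y, rfl⟩
  · obtain ⟨i, f₁, f₂, n, h₁, h₂⟩ := (Scheme.IsLocallyDirected.ι_eq_ι_iff (span j₁ j₂)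
      (i := WalkingSpan.left) (j := WalkingSpan.right)).mp h
    rcases i with (_ | (_ | _))
    · obtain rfl : f₁ = WalkingSpan.Hom.fst := Subsingleton.elim _ _
      obtain rfl : f₂ = WalkingSpan.Hom.snd := Subsingleton.elim _ _
      exact ⟨n, h₁, h₂⟩
    · exact nomatch (f₂ : WidePushoutShape.Hom _ _)
    · exact nomatch (f₁ : WidePushoutShape.Hom _ _)

end EssFactorization

/-! ### Generic points in noetherian sober spaces -/

section Topology

open TopologicalSpace

lemma IsClosed.exists_finite_forall_exists_specializes {α : Type*} [TopologicalSpace α]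
    [NoetherianSpace α] [QuasiSober α] {s : Set α} (hs : IsClosed s) :
    ∃ F : Set α, F.Finite ∧ F ⊆ s ∧ ∀ z ∈ s, ∃ c ∈ F, c ⤳ z := by
  obtain ⟨S, hS, hcl, hirr, rfl⟩ := NoetherianSpace.exists_finite_set_isClosed_irreducible hs
  choose c hc using fun t : S ↦ QuasiSober.sober (hirr t t.2) (hcl t t.2)
  have := hS.to_subtype
  refine ⟨Set.range c, Set.finite_range c, ?_, ?_⟩
  · rintro _ ⟨t, rfl⟩
    exact ⟨t, t.2, (hc t).mem⟩
  · rintro z ⟨t, ht, hz⟩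
    exact ⟨c ⟨t, ht⟩, ⟨_, rfl⟩, (hc ⟨t, ht⟩).specializes hz⟩

/-- The closure of the image is the union of the closures of the images of finitely many generic
points. -/
lemma Continuous.exists_specializes_of_mem_closure_range {α β : Type*} [TopologicalSpace α]
    [NoetherianSpace α] [QuasiSober α] [TopologicalSpace β] {f : α → β} (hf : Continuous f)
    {z : β} (hz : z ∈ closure (Set.range f)) : ∃ y, f y ⤳ z := by
  obtain ⟨F, hF, -, h⟩ := (isClosed_univ (X := α)).exists_finite_forall_exists_specializes
  have hcl : IsClosed (⋃ c ∈ F, closure {f c}) := hF.isClosed_biUnion fun _ _ ↦ isClosed_closure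
  have hsub : Set.range f ⊆ ⋃ c ∈ F, closure {f c} := by
    rintro _ ⟨y, rfl⟩
    obtain ⟨c, hc, hcy⟩ := h y trivial
    exact Set.mem_biUnion hc (hcy.map hf).mem_closure
  obtain ⟨c, -, hc⟩ := Set.mem_iUnion₂.mp (closure_minimal hsub hcl hz)
  exact ⟨c, specializes_iff_mem_closure.mpr hc⟩

end Topology

namespace EssFactorization

/-! ### Shrinking `Y` to a separated neighbourhood of `X` -/

section Separated

variable {X Y S : Scheme.{u}} (k : X ⟶ Y) (p : Y ⟶ S)

/-- The morphism `X ×[S] X ⟶ Y ×[S] Y` induced by an `S`-morphism `X ⟶ Y`. -/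
noncomputable abbrev selfProd : pullback (k ≫ p) (k ≫ p) ⟶ pullback p p :=
  pullback.map (k ≫ p) (k ≫ p) p p k k (𝟙 S) (by simp) (by simp)

lemma range_selfProd : Set.range (selfProd k p) =
    pullback.fst p p ⁻¹' Set.range k ∩ pullback.snd p p ⁻¹' Set.range k :=
  Scheme.Pullback.range_map ..

lemma selfProd_fst : selfProd k p ≫ pullback.fst p p = pullback.fst _ _ ≫ k :=
  pullback.lift_fst _ _ _

lemma selfProd_snd : selfProd k p ≫ pullback.snd p p = pullback.snd _ _ ≫ k :=
  pullback.lift_snd _ _ _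

lemma diagonal_comp_selfProd :
    pullback.diagonal (k ≫ p) ≫ selfProd k p = k ≫ pullback.diagonal p := by
  apply pullback.hom_ext
  · rw [Category.assoc, selfProd_fst, pullback.diagonal_fst_assoc, Category.assoc,
      pullback.diagonal_fst, Category.comp_id]
  · rw [Category.assoc, selfProd_snd, pullback.diagonal_snd_assoc, Category.assoc,
      pullback.diagonal_snd, Category.comp_id]

/-- The preimage of the diagonal is `X ×[Y] X`, which is `X` for a monomorphism. -/
lemma preimage_range_diagonal [Mono k] :
    selfProd k p ⁻¹' Set.range (pullback.diagonal p) =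
      Set.range (pullback.diagonal (k ≫ p)) := by
  ext z
  constructor
  · rintro ⟨y, hy⟩
    obtain ⟨w, -, rfl⟩ := Scheme.exists_preimage_of_isPullback
      (pullback_map_diagonal_isPullback k k p) y z hy
    refine ⟨pullback.fst k k w, ?_⟩
    rw [← Scheme.Hom.comp_apply]
    refine congrArg (fun g : pullback k k ⟶ pullback (k ≫ p) (k ≫ p) ↦ g w) ?_
    apply pullback.hom_ext
    · rw [Category.assoc, pullback.diagonal_fst, pullback.lift_fst]
    · rw [Category.assoc, pullback.diagonal_snd, pullback.lift_snd, Category.comp_id,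
        Category.comp_id, fst_eq_snd_of_mono_eq k]
  · rintro ⟨x, rfl⟩
    refine ⟨k x, ?_⟩
    rw [← Scheme.Hom.comp_apply, ← Scheme.Hom.comp_apply, diagonal_comp_selfProd]

instance flat_selfProd [Flat k] : Flat (selfProd k p) :=
  MorphismProperty.pullbackMap (P := @Flat) ‹_› ‹_› rfl rfl

lemma isSeparated_iff_isClosed_range : IsSeparated p ↔
    IsClosed (Set.range (pullback.diagonal p)) :=
  ⟨fun _ ↦ (pullback.diagonal p).isClosedEmbedding.isClosed_range,
    fun h ↦ ⟨.of_isPreimmersion _ h⟩⟩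

/-- A point in the closure of the diagonal of `Y` that lies in the image of `X ×[S] X` lies on the
diagonal, provided `X` is separated and flat over `Y`. -/
lemma disjoint_closure_diff_range [Mono k] [Flat k] [IsSeparated (k ≫ p)] [IsNoetherian Y] :
    Disjoint (closure (Set.range (pullback.diagonal p)) \ Set.range (pullback.diagonal p))
      (Set.range (selfProd k p)) := by
  rw [Set.disjoint_right]
  rintro _ ⟨z, rfl⟩ ⟨hz, hz'⟩
  obtain ⟨y, hy⟩ := (pullback.diagonal p).continuous.exists_specializes_of_mem_closure_range hz
  -- Flatness lifts the generalization of the image of `z` to a generalization `d` of `z`. It lies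
  -- on the diagonal of `X`, which is closed and so contains `z`.
  obtain ⟨d, hd, hdy⟩ := Flat.generalizingMap (selfProd k p) hy
  refine hz' ?_
  change z ∈ selfProd k p ⁻¹' Set.range (pullback.diagonal p)
  have hd' : d ∈ selfProd k p ⁻¹' Set.range (pullback.diagonal p) := ⟨y, hdy.symm⟩
  rw [preimage_range_diagonal] at hd' ⊢
  exact hd.mem_closed ((isSeparated_iff_isClosed_range _).mp ‹_›) hd'

lemma isSeparated_restrict (U : Y.Opens)
    (hU : ∀ z ∈ closure (Set.range (pullback.diagonal p)), pullback.fst p p z ∈ U →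
      pullback.snd p p z ∈ U → z ∈ Set.range (pullback.diagonal p)) : IsSeparated (U.ι ≫ p) := by
  rw [isSeparated_iff_isClosed_range, ← preimage_range_diagonal U.ι p]
  have : selfProd U.ι p ⁻¹' Set.range (pullback.diagonal p) =
      selfProd U.ι p ⁻¹' closure (Set.range (pullback.diagonal p)) := by
    refine (Set.preimage_mono subset_closure).antisymm fun z hz ↦ hU _ hz ?_ ?_
    · have : selfProd U.ι p z ∈ Set.range (selfProd U.ι p) := ⟨z, rfl⟩
      rw [range_selfProd] at this
      simpa using this.1
    · have : selfProd U.ι p z ∈ Set.range (selfProd U.ι p) := ⟨z, rfl⟩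
      rw [range_selfProd] at this
      simpa using this.2
  rw [this]
  exact isClosed_closure.preimage (selfProd U.ι p).continuous

lemma exists_open_isSeparated [Mono k] [Flat k] [IsSeparated (k ≫ p)] [IsNoetherian S]
    [LocallyOfFiniteType p] [QuasiCompact p] :
    ∃ U : Y.Opens, Set.range k ⊆ U ∧ IsSeparated (U.ι ≫ p) := by
  have hY : IsLocallyNoetherian Y := LocallyOfFiniteType.isLocallyNoetherian p
  have : CompactSpace Y := QuasiCompact.compactSpace_of_compactSpace p
  have : IsNoetherian Y := ⟨⟩
  have : IsLocallyNoetherian (↑(pullback p p) : Scheme) :=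
    LocallyOfFiniteType.isLocallyNoetherian (pullback.fst p p)
  have : CompactSpace (↑(pullback p p) : Scheme) :=
    QuasiCompact.compactSpace_of_compactSpace (pullback.fst p p)
  have : IsNoetherian (↑(pullback p p) : Scheme) := ⟨⟩
  set D := Set.range (pullback.diagonal p)
  -- The diagonal is an immersion, so `D` is locally closed.
  have hC : IsClosed (closure D \ D) := by
    have := (pullback.diagonal p).isLocallyClosed_range.isOpen_coborder
    rwa [coborder, isOpen_compl_iff] at this
  obtain ⟨F, hF, hFC, hspec⟩ := hC.exists_finite_forall_exists_specializes
  have hgen (c : F) : ∃ y, y ∉ Set.range k ∧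
      (y = pullback.fst p p c.1 ∨ y = pullback.snd p p c.1) := by
    have := (Set.disjoint_left.mp (disjoint_closure_diff_range k p)) (hFC c.2)
    rw [range_selfProd, Set.mem_inter_iff, not_and_or] at this
    rcases this with h | h
    · exact ⟨_, h, .inl rfl⟩
    · exact ⟨_, h, .inr rfl⟩
  choose y hyk hy using hgen
  let Z : Set Y := ⋃ c : F, closure {y c}
  have := hF.to_subtype
  have hZ : IsClosed Z := isClosed_iUnion_of_finite fun _ ↦ isClosed_closure
  refine ⟨⟨Zᶜ, hZ.isOpen_compl⟩, ?_, isSeparated_restrict p _ fun z hz h₁ h₂ ↦ ?_⟩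
  · rintro _ ⟨x, rfl⟩ hx
    obtain ⟨c, hcx⟩ := Set.mem_iUnion.mp hx
    -- The image of a flat morphism is stable under generalization, so it misses the closure of any
    -- point outside it.
    obtain ⟨x', -, hx'⟩ := Flat.generalizingMap k (specializes_iff_mem_closure.mpr hcx)
    exact hyk c ⟨x', hx'⟩
  · by_contra hzD
    obtain ⟨c, hc, hcz⟩ := hspec z ⟨hz, hzD⟩
    rcases hy ⟨c, hc⟩ with h | h
    · refine h₁ (Set.mem_iUnion.mpr ⟨⟨c, hc⟩, ?_⟩)
      rw [h]
      exact (hcz.map (pullback.fst p p).continuous).mem_closure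
    · refine h₂ (Set.mem_iUnion.mpr ⟨⟨c, hc⟩, ?_⟩)
      rw [h]
      exact (hcz.map (pullback.snd p p).continuous).mem_closure

end Separated

/-! ### Gluing two factorizations -/

section Glue

variable {X X₁ X₂ S T : Scheme.{u}}

/-- The open cover of `X` by two jointly surjective open immersions. -/
def binaryOpenCover (u₁ : X₁ ⟶ X) (u₂ : X₂ ⟶ X) [IsOpenImmersion u₁] [IsOpenImmersion u₂]
    (hu : ∀ x, x ∈ Set.range u₁ ∨ x ∈ Set.range u₂) : X.OpenCover where
  I₀ := Bool
  X b := match b with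
    | true => X₁
    | false => X₂
  f b := match b with
    | true => u₁
    | false => u₂
  mem₀ := by
    rw [Scheme.presieve₀_mem_precoverage_iff]
    refine ⟨fun x ↦ ?_, ?_⟩
    · rcases hu x with h | h
      exacts [⟨true, h⟩, ⟨false, h⟩]
    · rintro (_ | _)
      exacts [‹IsOpenImmersion u₂›, ‹IsOpenImmersion u₁›]

lemma compactSpace_of_range_union (u₁ : X₁ ⟶ X) (u₂ : X₂ ⟶ X)
    (hu : ∀ x, x ∈ Set.range u₁ ∨ x ∈ Set.range u₂)
    [CompactSpace X₁] [CompactSpace X₂] : CompactSpace X := by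
  refine ⟨?_⟩
  convert (isCompact_range u₁.continuous).union (isCompact_range u₂.continuous)
  exact (Set.eq_univ_of_forall hu).symm

section

variable (u₁ : X₁ ⟶ X) (u₂ : X₂ ⟶ X) [IsOpenImmersion u₁] [IsOpenImmersion u₂]

lemma hom_ext_of_range_union (hu : ∀ x, x ∈ Set.range u₁ ∨ x ∈ Set.range u₂)
    {g g' : X ⟶ T} (h₁ : u₁ ≫ g = u₁ ≫ g')
    (h₂ : u₂ ≫ g = u₂ ≫ g') : g = g' := by
  refine (binaryOpenCover u₁ u₂ hu).hom_ext _ _ ?_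
  rintro (_ | _)
  exacts [h₂, h₁]

lemma exists_desc_of_range_union (hu : ∀ x, x ∈ Set.range u₁ ∨ x ∈ Set.range u₂)
    (g₁ : X₁ ⟶ T) (g₂ : X₂ ⟶ T)
    (h : pullback.fst u₁ u₂ ≫ g₁ = pullback.snd u₁ u₂ ≫ g₂) :
    ∃ g : X ⟶ T, u₁ ≫ g = g₁ ∧ u₂ ≫ g = g₂ := by
  let 𝒰 := binaryOpenCover u₁ u₂ hu
  let g' : ∀ b, 𝒰.X b ⟶ T := fun b ↦ match b with
    | true => g₁
    | false => g₂
  have hg (i j) : pullback.fst (𝒰.f i) (𝒰.f j) ≫ g' i = pullback.snd _ _ ≫ g' j := by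
    rcases i with (_ | _) <;> rcases j with (_ | _)
    · change pullback.fst u₂ u₂ ≫ g₂ = pullback.snd u₂ u₂ ≫ g₂
      rw [fst_eq_snd_of_mono_eq]
    · change pullback.fst u₂ u₁ ≫ g₂ = pullback.snd u₂ u₁ ≫ g₁
      rw [← pullbackSymmetry_hom_comp_fst, ← pullbackSymmetry_hom_comp_snd, Category.assoc,
        Category.assoc, h]
    · exact h
    · change pullback.fst u₁ u₁ ≫ g₁ = pullback.snd u₁ u₁ ≫ g₁
      rw [fst_eq_snd_of_mono_eq]
  exact ⟨𝒰.glueMorphisms g' hg, 𝒰.ι_glueMorphisms g' hg true, 𝒰.ι_glueMorphisms g' hg false⟩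

lemma locallyOfFiniteType_of_range_union (hu : ∀ x, x ∈ Set.range u₁ ∨ x ∈ Set.range u₂)
    {p : X ⟶ S} [LocallyOfFiniteType (u₁ ≫ p)]
    [LocallyOfFiniteType (u₂ ≫ p)] : LocallyOfFiniteType p := by
  have : IsZariskiLocalAtSource @LocallyOfFiniteType :=
    HasRingHomProperty.instIsZariskiLocalAtSource
  refine IsZariskiLocalAtSource.of_openCover (P := @LocallyOfFiniteType)
    (binaryOpenCover u₁ u₂ hu) ?_
  rintro (_ | _)
  exacts [‹LocallyOfFiniteType (u₂ ≫ p)›, ‹LocallyOfFiniteType (u₁ ≫ p)›]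

end

/-- The property that `f` factors as an injective localizing morphism followed by a separated
morphism of finite type. -/
def HasFactorization (f : X ⟶ S) : Prop :=
  ∃ (Y : Scheme.{u}) (k : X ⟶ Y) (p : Y ⟶ S), k ≫ p = f ∧
    IsInjLocalizing k ∧ IsSeparated p ∧ LocallyOfFiniteType p ∧ QuasiCompact p

lemma HasFactorization.of_iso {f : X ⟶ S} (hf : HasFactorization f) (e : T ⟶ X) [IsIso e] :
    HasFactorization (e ≫ f) := by
  obtain ⟨Y, k, p, rfl, hk, h⟩ := hf
  exact ⟨Y, e ≫ k, p, Category.assoc _ _ _,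
    hk.of_isPullback (i := e) (j := 𝟙 _) (IsPullback.of_horiz_isIso ⟨by simp⟩), h⟩

lemma IsInjLocalizing.exists_isPullback {Y : Scheme.{u}} {k : X ⟶ Y} (hk : IsInjLocalizing k)
    (a : T ⟶ X) [IsOpenImmersion a] :
    ∃ (W : Y.Opens) (k' : T ⟶ W), IsPullback a k' k W.ι := by
  have := hk.isPreimmersion
  obtain ⟨W, hW, h⟩ := k.isEmbedding.isOpen_iff.mp a.opensRange.isOpen
  have hW' : k ⁻¹ᵁ ⟨W, hW⟩ = a.opensRange := by
    ext1
    exact h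
  have hr : Set.range (a ≫ k) ⊆ Set.range (Scheme.Opens.ι (⟨W, hW⟩ : Y.Opens)) := by
    rintro _ ⟨x, rfl⟩
    have : a x ∈ a.opensRange := ⟨x, rfl⟩
    rw [← hW'] at this
    simpa using this
  refine ⟨⟨W, hW⟩, IsOpenImmersion.lift _ (a ≫ k) hr, (IsOpenImmersion.isPullback _ _ _ _
    (IsOpenImmersion.lift_fac _ _ _).symm ?_).flip⟩
  rw [Scheme.Opens.opensRange_ι, hW']

/-- Only the composite is assumed separated; `p` becomes so after shrinking `Y` around the image of
`k`. -/
lemma IsInjLocalizing.hasFactorization {Y : Scheme.{u}} {k : X ⟶ Y} {p : Y ⟶ S}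
    (hk : IsInjLocalizing k) [IsSeparated (k ≫ p)] [IsNoetherian S] [LocallyOfFiniteType p]
    [QuasiCompact p] : HasFactorization (k ≫ p) := by
  have := hk.isPreimmersion
  have := hk.flat
  obtain ⟨U, hU, hs⟩ := exists_open_isSeparated k p
  have hr : Set.range k ⊆ Set.range U.ι := by simpa using hU
  have : IsLocallyNoetherian Y := LocallyOfFiniteType.isLocallyNoetherian p
  have : CompactSpace Y := QuasiCompact.compactSpace_of_compactSpace p
  have : IsNoetherian Y := ⟨⟩
  refine ⟨U, IsOpenImmersion.lift U.ι k hr, U.ι ≫ p, ?_,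
    hk.of_isPullback (IsOpenImmersion.isPullback_lift_id k U.ι hr).flip, hs, inferInstance,
    inferInstance⟩
  rw [← Category.assoc, IsOpenImmersion.lift_fac]

lemma preimage_opensRange_eq {Y Y₁ Y₂ : Scheme.{u}} {k : X ⟶ Y} {u₁ : X₁ ⟶ X} {u₂ : X₂ ⟶ X}
    {k₁ : X₁ ⟶ Y₁} {k₂ : X₂ ⟶ Y₂} {i₁ : Y₁ ⟶ Y} {i₂ : Y₂ ⟶ Y} [IsOpenImmersion u₁]
    [IsOpenImmersion i₁] (hu : ∀ x, x ∈ Set.range u₁ ∨ x ∈ Set.range u₂) (h₁ : u₁ ≫ k = k₁ ≫ i₁)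
    (h₂ : u₂ ≫ k = k₂ ≫ i₂) (H : ∀ x₂ y₁, i₁ y₁ = i₂ (k₂ x₂) → u₂ x₂ ∈ Set.range u₁) :
    k ⁻¹ᵁ i₁.opensRange = u₁.opensRange := by
  ext x
  constructor
  · rintro ⟨y, hy⟩
    rcases hu x with h | ⟨x₂, rfl⟩
    · exact h
    · refine H x₂ y (hy.trans ?_)
      rw [← Scheme.Hom.comp_apply, ← Scheme.Hom.comp_apply, h₂]
  · rintro ⟨x₁, rfl⟩
    refine ⟨k₁ x₁, ?_⟩
    rw [← Scheme.Hom.comp_apply, ← Scheme.Hom.comp_apply, h₁]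

/-- Factorizations over the two members of an open cover can be glued. -/
lemma HasFactorization.of_range_union {f : X ⟶ S} [IsLocallyNoetherian X] [IsNoetherian S]
    [IsSeparated f] (u₁ : X₁ ⟶ X) (u₂ : X₂ ⟶ X) [IsOpenImmersion u₁] [IsOpenImmersion u₂]
    (hu : ∀ x, x ∈ Set.range u₁ ∨ x ∈ Set.range u₂) (h₁ : HasFactorization (u₁ ≫ f))
    (h₂ : HasFactorization (u₂ ≫ f)) : HasFactorization f := by
  obtain ⟨Y₁, k₁, p₁, hf₁, hk₁, hs₁, ht₁, hq₁⟩ := h₁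
  obtain ⟨Y₂, k₂, p₂, hf₂, hk₂, hs₂, ht₂, hq₂⟩ := h₂
  have := LocallyOfFiniteType.isLocallyNoetherian p₁
  have := LocallyOfFiniteType.isLocallyNoetherian p₂
  have := QuasiCompact.compactSpace_of_compactSpace p₁
  have := QuasiCompact.compactSpace_of_compactSpace p₂
  -- `W₁` and `W₂` are opens of the two models whose traces on `X₁` and `X₂` are exactly the
  -- overlap.
  obtain ⟨W₁, l₁, hl₁⟩ := hk₁.exists_isPullback (pullback.fst u₁ u₂)
  obtain ⟨W₂, l₂, hl₂⟩ := hk₂.exists_isPullback (pullback.snd u₁ u₂)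
  have hkl₁ := hk₁.of_isPullback hl₁
  have hkl₂ := hk₂.of_isPullback hl₂
  have := hkl₁.isPreimmersion
  have := hkl₂.isPreimmersion
  have := hkl₁.flat
  have := hkl₂.flat
  have := hkl₁.isAffineHom
  have := hkl₂.isAffineHom
  have := hkl₁.isSchemeTheoreticallyDominant
  have := hkl₂.isSchemeTheoreticallyDominant
  have : IsLocallyNoetherian X₁ := isLocallyNoetherian_of_isOpenImmersion u₁
  have : IsLocallyNoetherian (pullback u₁ u₂ : Scheme.{u}) :=
    isLocallyNoetherian_of_isOpenImmersion (pullback.fst u₁ u₂)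
  obtain ⟨N, κ, j₁, j₂, hj₁, hj₂, hκ₁, hκ₂, hj⟩ := exists_common_open l₁ l₂ (W₁.ι ≫ p₁) (W₂.ι ≫ p₂)
    (by rw [← reassoc_of% hl₁.w, ← reassoc_of% hl₂.w, hf₁, hf₂, pullback.condition_assoc])
  obtain ⟨Y, i₁, i₂, hi₁, hi₂, hpo, hcov, heq⟩ := exists_glue (j₁ ≫ W₁.ι) (j₂ ≫ W₂.ι)
  obtain ⟨p, hp₁, hp₂⟩ : ∃ p : Y ⟶ S, i₁ ≫ p = p₁ ∧ i₂ ≫ p = p₂ :=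
    ⟨hpo.desc p₁ p₂ (by simpa using hj), hpo.inl_desc _ _ _, hpo.inr_desc _ _ _⟩
  obtain ⟨k, hk₁', hk₂'⟩ := exists_desc_of_range_union u₁ u₂ hu (k₁ ≫ i₁) (k₂ ≫ i₂) (by
    rw [reassoc_of% hl₁.w, reassoc_of% hl₂.w, ← hκ₁, ← hκ₂, Category.assoc, Category.assoc]
    exact congr(κ ≫ $(by simpa using hpo.w)))
  obtain rfl : k ≫ p = f := hom_ext_of_range_union u₁ u₂ hu
    (by rw [reassoc_of% hk₁', hp₁, hf₁]) (by rw [reassoc_of% hk₂', hp₂, hf₂])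
  -- A point of `X₂` landing in `Y₁` lands in the glued part, hence in `W₂`, whose preimage is the
  -- overlap. So `k` restricts over each `Yᵢ` to `kᵢ`.
  have hpre₁ : k ⁻¹ᵁ i₁.opensRange = u₁.opensRange :=
    preimage_opensRange_eq hu hk₁' hk₂' fun x y h ↦ by
      obtain ⟨n, -, hn⟩ := heq _ _ h
      obtain ⟨t, rfl, -⟩ := Scheme.exists_preimage_of_isPullback hl₂ x (j₂ n) hn.symm
      exact ⟨pullback.fst u₁ u₂ t, congr($(pullback.condition (f := u₁) (g := u₂)) t)⟩
  have hpre₂ : k ⁻¹ᵁ i₂.opensRange = u₂.opensRange :=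
    preimage_opensRange_eq (fun x ↦ (hu x).symm) hk₂' hk₁' fun x y h ↦ by
      obtain ⟨n, hn, -⟩ := heq _ _ h.symm
      obtain ⟨t, rfl, -⟩ := Scheme.exists_preimage_of_isPullback hl₁ x (j₁ n) hn.symm
      exact ⟨pullback.snd u₁ u₂ t, congr($(pullback.condition (f := u₁) (g := u₂)) t).symm⟩
  have hk : IsInjLocalizing k := .of_forall_exists fun y ↦ by
    rcases hcov y with hy | hy
    · exact ⟨_, _, u₁, k₁, i₁, hi₁, hy, (IsOpenImmersion.isPullback _ _ _ _ hk₁' hpre₁).flip, hk₁⟩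
    · exact ⟨_, _, u₂, k₂, i₂, hi₂, hy, (IsOpenImmersion.isPullback _ _ _ _ hk₂' hpre₂).flip, hk₂⟩
  have : LocallyOfFiniteType (i₁ ≫ p) := by rwa [hp₁]
  have : LocallyOfFiniteType (i₂ ≫ p) := by rwa [hp₂]
  have : LocallyOfFiniteType p := locallyOfFiniteType_of_range_union i₁ i₂ hcov
  have : IsLocallyNoetherian Y := LocallyOfFiniteType.isLocallyNoetherian p
  have : CompactSpace Y := compactSpace_of_range_union i₁ i₂ hcov
  have : IsNoetherian Y := ⟨⟩
  exact hk.hasFactorization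

end Glue

/-! ### From affine pieces to the theorem -/

variable {X S : Scheme.{u}}

lemma HasFactorization.of_isAffineOpen [IsNoetherian S] (f : X ⟶ S) {V : S.Opens} {U : X.Opens}
    (hV : IsAffineOpen V) (hU : IsAffineOpen U) (h : U ≤ f ⁻¹ᵁ V)
    (hf : (f.appLE V U h).hom.EssFiniteType) : HasFactorization (U.ι ≫ f) := by
  have : IsAffine V := hV
  have : IsAffine U := hU
  obtain ⟨Y, k, p, hkp, hk, hs, ht, hq⟩ :=
    IsInjLocalizing.exists_factorization_of_isAffine (f.resLE V U h)
      ((RingHom.EssFiniteType.respectsIso.arrow_mk_iso_iff (arrowResLEAppIso f V U h)).mpr hf)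
  -- `V.ι` is quasi-compact because `S` is noetherian.
  refine ⟨Y, k, p ≫ V.ι, ?_, hk, inferInstance, inferInstance, inferInstance⟩
  rw [reassoc_of% hkp, Scheme.Hom.resLE_comp_ι]

lemma HasFactorization.of_isEmpty [IsEmpty X] (f : X ⟶ S) : HasFactorization f :=
  ⟨X, 𝟙 X, f, Category.id_comp f, .of_isIso, inferInstance, inferInstance, inferInstance⟩

lemma HasFactorization.sup [IsNoetherian X] [IsNoetherian S] (f : X ⟶ S) [IsSeparated f]
    {U V : X.Opens} (hU : HasFactorization (U.ι ≫ f)) (hV : HasFactorization (V.ι ≫ f)) :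
    HasFactorization ((U ⊔ V).ι ≫ f) := by
  refine .of_range_union (X.homOfLE le_sup_left) (X.homOfLE le_sup_right) (fun x ↦ ?_)
    (by rwa [Scheme.homOfLE_ι_assoc]) (by rwa [Scheme.homOfLE_ι_assoc])
  obtain ⟨x, h | h⟩ := x
  · exact Or.inl ⟨⟨x, h⟩, Scheme.homOfLE_apply' _ _ _⟩
  · exact Or.inr ⟨⟨x, h⟩, Scheme.homOfLE_apply' _ _ _⟩

/-- A factorization exists as soon as it exists locally on the source. -/
lemma HasFactorization.of_forall_exists [IsNoetherian X] [IsNoetherian S] (f : X ⟶ S)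
    [IsSeparated f] (H : ∀ x : X, ∃ U : X.Opens, x ∈ U ∧ HasFactorization (U.ι ≫ f)) :
    HasFactorization f := by
  choose U hxU hU using H
  obtain ⟨t, ht⟩ := CompactSpace.elim_nhds_subcover (fun x ↦ (U x : Set X))
    fun x ↦ (U x).isOpen.mem_nhds (hxU x)
  have key : HasFactorization ((t.sup U).ι ≫ f) := by
    refine Finset.sup_induction (p := fun V : X.Opens ↦ HasFactorization (V.ι ≫ f)) ?_
      (fun _ h₁ _ h₂ ↦ h₁.sup f h₂) fun x _ ↦ hU x
    have : IsEmpty (⊥ : X.Opens).toScheme := inferInstanceAs (IsEmpty (∅ : Set X))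
    exact .of_isEmpty _
  have htop : t.sup U = ⊤ := by
    ext1
    simpa [Finset.sup_eq_iSup] using ht
  rw [htop] at key
  simpa using key.of_iso X.topIso.inv

end EssFactorization

theorem mainTheorem1 {X S : Scheme.{u}} [IsNoetherian X] [IsNoetherian S] (f : X ⟶ S)
    (hsep : IsSeparated f) (hf : EssFactorization.IsEssFiniteType f) :
    ∃ (Y : Scheme.{u}) (k : X ⟶ Y) (p : Y ⟶ S), k ≫ p = f ∧
      IsNoetherian Y ∧
      EssFactorization.IsLocalizingImmersion k ∧
      IsSeparated p ∧ LocallyOfFiniteType p ∧ QuasiCompact p := by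
  obtain ⟨Y, k, p, h, hk, hs, ht, hq⟩ := EssFactorization.HasFactorization.of_forall_exists f
    fun x ↦ by
      obtain ⟨V, hxV, hV, n, U, hU, hUV, hUf⟩ := hf (f x)
      have hx : x ∈ ⨆ i, U i := hUV.ge hxV
      obtain ⟨i, hi⟩ := TopologicalSpace.Opens.mem_iSup.mp hx
      exact ⟨U i, hi, .of_isAffineOpen f hV (hUf i).1 (hU i) (hUf i).2⟩
  have := LocallyOfFiniteType.isLocallyNoetherian p
  have := QuasiCompact.compactSpace_of_compactSpace p
  exact ⟨Y, k, p, h, ⟨⟩, hk.isLocalizingImmersion, hs, ht, hq⟩
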